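/- Let $K=\{k_A\}$ be a finite family of fields. Let $K\text{-Mod-}K$ be the 2-category whose objects are the members of $K$, whose 1-morphisms from $k_A$ to $k_B$ are the $k_A$-$k_B$-bimodules (abelian groups with a left $k_A$-action and a commuting right $k_B$-action), composed by the tensor product $V\otimes_{k_B}W$ over the middle field, and whose 2-morphisms are the bimodule homomorphisms. Let $\mathcal{D}$ be a full sub-2-category of $K\text{-Mod-}K$: a class of bimodules containing the identity bimodules $k_A$ and closed under composition, with all bimodule homomorphisms between them. Assume that $\mathcal{D}$ is - connected: any two objects are linked by a chain of nonzero 1-morphisms of $\mathcal{D}$ (each in either direction); - rigid: every 1-morphism of $\mathcal{D}$ has a left dual and a right dual in $\mathcal{D}$; - semisimple: every category $\mathcal{D}(A,B)$ of 1-morphisms is abelian, and each of its objects is a direct sum of finitely many simple objects; that $\mathcal{D}$ has only finitely many simple 1-morphisms up to isomorphism, and that it has no inseparable extensions: for every simple 1-morphism $V\in\mathcal{D}(A,B)$ the compositum $k_V\subseteq\mathrm{End}(V)$ of the images of $k_A$ and $k_B$ (acting on $V$ by left and right multiplication) is separable over both $k_A$ and $k_B$. Then there are a field $k$ and field embeddings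 $\beta_A:k\to k_A$ for all $A$ such that $\mathcal{D}$ admits a forgetful functor to the category of finite-dimensional $k$-vector spaces. That is, for every 1-morphism $V\in\mathcal{D}(A,B)$ the action of $k$ on $V$ on the left through $\beta_A$ and that on the right through $\beta_B$ coincide and make $V$ a finite-dimensional $k$-vector space; and sending $V$ to this vector space, and each bimodule homomorphism to itself, is a lax 2-functor from $\mathcal{D}$ to the monoidal category of finite-dimensional $k$-vector spaces, with the structure maps $\beta_A:k\to k_A$ and the canonical projections $V\otimes_k W\to V\otimes_{k_B}W$. -/

import Mathlib

open CategoryTheory TensorProduct MulOpposite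

universe w v u

/-! ### Bimodules over fields -/

/-- An `R`-`S`-bimodule: an abelian group with commuting left `R`-action and right `S`-action. -/
structure FieldBimodule (R S : Type u) [Field R] [Field S] where
  /-- The underlying abelian group. -/
  carrier : Type u
  [addCommGroup : AddCommGroup carrier]
  [leftModule : Module R carrier]
  [rightModule : Module Sᵐᵒᵖ carrier]
  [smulComm : SMulCommClass R Sᵐᵒᵖ carrier]

namespace FieldBimodule

attribute [instance] addCommGroup leftModule rightModule smulComm

variable {R S T U : Type u} [Field R] [Field S] [Field T] [Field U]

instance : CoeSort (FieldBimodule R S) (Type u) := ⟨carrier⟩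

/-- A homomorphism of bimodules. -/
@[ext]
structure Hom (V W : FieldBimodule R S) where
  /-- The underlying additive map. -/
  hom : V →+ W
  map_left : ∀ (r : R) (v : V), hom (r • v) = r • hom v
  map_right : ∀ (s : S) (v : V), hom (op s • v) = op s • hom v

instance : Category (FieldBimodule R S) where
  Hom V W := Hom V W
  id V := ⟨AddMonoidHom.id V, fun _ _ => rfl, fun _ _ => rfl⟩
  comp f g := ⟨g.hom.comp f.hom, fun r v => by simp [f.map_left, g.map_left],
    fun s v => by simp [f.map_right, g.map_right]⟩

@[simp] lemma id_hom_apply (V : FieldBimodule R S) (v : V) : Hom.hom (𝟙 V) v = v := rfl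

@[simp] lemma comp_hom_apply {V W X : FieldBimodule R S} (f : V ⟶ W) (g : W ⟶ X) (v : V) :
    Hom.hom (f ≫ g) v = g.hom (f.hom v) := rfl

lemma hom_ext {V W : FieldBimodule R S} {f g : V ⟶ W} (h : ∀ v, f.hom v = g.hom v) : f = g :=
  Hom.ext (AddMonoidHom.ext h)

section Preadditive

variable (V W : FieldBimodule R S)

instance : Zero (V ⟶ W) := ⟨⟨0, by simp, by simp⟩⟩

instance : Add (V ⟶ W) := ⟨fun f g => ⟨f.hom + g.hom,
  by simp [f.map_left, g.map_left], by simp [f.map_right, g.map_right]⟩⟩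

instance : Neg (V ⟶ W) := ⟨fun f => ⟨-f.hom, by simp [f.map_left], by simp [f.map_right]⟩⟩

instance : Sub (V ⟶ W) := ⟨fun f g => ⟨f.hom - g.hom,
  by simp [f.map_left, g.map_left, smul_sub], by simp [f.map_right, g.map_right, smul_sub]⟩⟩

instance : SMul ℕ (V ⟶ W) := ⟨fun n f => ⟨n • f.hom,
  by simp [f.map_left, smul_comm n], by simp [f.map_right, smul_comm n]⟩⟩

instance : SMul ℤ (V ⟶ W) := ⟨fun n f => ⟨n • f.hom,
  by simp [f.map_left, smul_comm n], by simp [f.map_right, smul_comm n]⟩⟩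

instance : AddCommGroup (V ⟶ W) :=
  Function.Injective.addCommGroup (fun f : V ⟶ W => f.hom) (fun _ _ h => Hom.ext h)
    rfl (fun _ _ => rfl) (fun _ => rfl) (fun _ _ => rfl) (fun _ _ => rfl) (fun _ _ => rfl)

end Preadditive

@[simp] lemma zero_hom_apply {V W : FieldBimodule R S} (v : V) :
    Hom.hom (0 : V ⟶ W) v = 0 := rfl

@[simp] lemma add_hom_apply {V W : FieldBimodule R S} (f g : V ⟶ W) (v : V) :
    Hom.hom (f + g) v = f.hom v + g.hom v := rfl

instance : Preadditive (FieldBimodule R S) where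
  add_comp _ _ _ f f' g := hom_ext fun v => by simp
  comp_add _ _ _ f g g' := hom_ext fun v => by simp

/-- An isomorphism of bimodules from a pair of mutually inverse homomorphisms. -/
def mkIso {V W : FieldBimodule R S} (f : V ⟶ W) (g : W ⟶ V)
    (h : ∀ v, g.hom (f.hom v) = v) (h' : ∀ w, f.hom (g.hom w) = w) : V ≅ W where
  hom := f
  inv := g
  hom_inv_id := hom_ext h
  inv_hom_id := hom_ext h'

/-! ### The tensor product of bimodules over the middle field -/

/-- The right vector space underlying a bimodule, written as a vector space over the
commutative field `S`. -/
def RightMod (V : FieldBimodule R S) : Type u := V.carrier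

instance (V : FieldBimodule R S) : AddCommGroup V.RightMod :=
  inferInstanceAs (AddCommGroup V.carrier)

instance (V : FieldBimodule R S) : Module S V.RightMod :=
  Module.compHom V.carrier (RingEquiv.toOpposite S).toRingHom

/-- Left multiplications, as endomorphisms of the right vector space. -/
def leftEnd (V : FieldBimodule R S) : R →+* Module.End S V.RightMod where
  toFun r :=
    { toFun := fun v => (r • (show V.carrier from v) : V.carrier)
      map_add' := fun v w => smul_add r (show V.carrier from v) (show V.carrier from w)
      map_smul' := fun s v => smul_comm r (op s) (show V.carrier from v) }
  map_one' := LinearMap.ext fun v => one_smul R (show V.carrier from v)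
  map_mul' r r' := LinearMap.ext fun v => mul_smul r r' (show V.carrier from v)
  map_zero' := LinearMap.ext fun v => zero_smul R (show V.carrier from v)
  map_add' r r' := LinearMap.ext fun v => add_smul r r' (show V.carrier from v)

/-- Right multiplications, as endomorphisms of the left vector space. -/
def rightEnd (W : FieldBimodule S T) : Tᵐᵒᵖ →+* Module.End S W where
  toFun t :=
    { toFun := fun w => t • w
      map_add' := smul_add t
      map_smul' := fun s w => (smul_comm s t w).symm }
  map_one' := LinearMap.ext fun w => one_smul _ w
  map_mul' r r' := LinearMap.ext fun w => mul_smul r r' w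
  map_zero' := LinearMap.ext fun w => zero_smul _ w
  map_add' r r' := LinearMap.ext fun w => add_smul r r' w

/-- The left action on a tensor product. -/
noncomputable def tensorLeftEnd (V : FieldBimodule R S) (W : FieldBimodule S T) :
    R →+* Module.End S (V.RightMod ⊗[S] W) where
  toFun r := (V.leftEnd r).rTensor W
  map_one' := by rw [map_one]; exact LinearMap.rTensor_id _ _
  map_mul' r r' := by rw [map_mul]; exact LinearMap.rTensor_mul _ _ _
  map_zero' := by rw [map_zero]; exact LinearMap.rTensor_zero _
  map_add' r r' := by rw [map_add]; exact LinearMap.rTensor_add _ _ _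

/-- The right action on a tensor product. -/
noncomputable def tensorRightEnd (V : FieldBimodule R S) (W : FieldBimodule S T) :
    Tᵐᵒᵖ →+* Module.End S (V.RightMod ⊗[S] W) where
  toFun t := (W.rightEnd t).lTensor V.RightMod
  map_one' := by rw [map_one]; exact LinearMap.lTensor_id _ _
  map_mul' r r' := by rw [map_mul]; exact LinearMap.lTensor_mul _ _ _
  map_zero' := by rw [map_zero]; exact LinearMap.lTensor_zero _
  map_add' r r' := by rw [map_add]; exact LinearMap.lTensor_add _ _ _

/-- The tensor product `V ⊗_S W` of an `R`-`S`-bimodule and an `S`-`T`-bimodule. -/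
noncomputable def tensor (V : FieldBimodule R S) (W : FieldBimodule S T) : FieldBimodule R T where
  carrier := V.RightMod ⊗[S] W
  addCommGroup := inferInstance
  leftModule := Module.compHom (V.RightMod ⊗[S] W) (tensorLeftEnd V W)
  rightModule := Module.compHom (V.RightMod ⊗[S] W) (tensorRightEnd V W)
  smulComm :=
    letI : Module R (V.RightMod ⊗[S] W) := Module.compHom _ (tensorLeftEnd V W)
    letI : Module Tᵐᵒᵖ (V.RightMod ⊗[S] W) := Module.compHom _ (tensorRightEnd V W)
    ⟨fun r t x => by
      change (V.leftEnd r).rTensor W ((W.rightEnd t).lTensor V.RightMod x) =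
        (W.rightEnd t).lTensor V.RightMod ((V.leftEnd r).rTensor W x)
      rw [← LinearMap.comp_apply, ← LinearMap.comp_apply, LinearMap.rTensor_comp_lTensor,
        LinearMap.lTensor_comp_rTensor]⟩

/-- A pure tensor in `V ⊗_S W`. -/
noncomputable def tmul {V : FieldBimodule R S} {W : FieldBimodule S T} (v : V) (w : W) :
    tensor V W :=
  TensorProduct.tmul S (M := V.RightMod) v w

section tmul

variable {V : FieldBimodule R S} {W : FieldBimodule S T}

lemma tmul_add (v : V) (w w' : W) : tmul v (w + w') = tmul v w + tmul v w' :=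
  TensorProduct.tmul_add (R := S) (M := V.RightMod) v w w'

lemma add_tmul (v v' : V) (w : W) : tmul (v + v') w = tmul v w + tmul v' w :=
  TensorProduct.add_tmul (R := S) (M := V.RightMod) v v' w

lemma balanced (s : S) (v : V) (w : W) : tmul (op s • v) w = tmul v (s • w) :=
  TensorProduct.smul_tmul (R := S) (M := V.RightMod) s v w

lemma smul_tmul_left (r : R) (v : V) (w : W) : r • tmul v w = tmul (r • v) w := rfl

lemma smul_tmul_right (t : T) (v : V) (w : W) : op t • tmul v w = tmul v (op t • w) := rfl

lemma tensor_induction {p : tensor V W → Prop} (x : tensor V W) (zero : p 0)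
    (tmul : ∀ v w, p (tmul v w)) (add : ∀ x y, p x → p y → p (x + y)) : p x :=
  TensorProduct.induction_on (motive := p) x zero tmul add

/-- A biadditive balanced map induces an additive map on the tensor product. -/
noncomputable def liftAdd {A : Type*} [AddCommGroup A] (f : V →+ W →+ A)
    (hb : ∀ (s : S) (v : V) (w : W), f (op s • v) w = f v (s • w)) : tensor V W →+ A :=
  TensorProduct.liftAddHom (R := S) (M := V.RightMod) f hb

@[simp] lemma liftAdd_tmul {A : Type*} [AddCommGroup A] (f : V →+ W →+ A) (hb) (v : V) (w : W) :
    (liftAdd f hb : tensor V W →+ A) (tmul v w) = f v w := rfl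

/-- A biadditive balanced map that respects the outer actions induces a homomorphism on
the tensor product. -/
noncomputable def lift {X : FieldBimodule R T} (f : V →+ W →+ X)
    (hb : ∀ (s : S) (v : V) (w : W), f (op s • v) w = f v (s • w))
    (hl : ∀ (r : R) (v : V) (w : W), f (r • v) w = r • f v w)
    (hr : ∀ (t : T) (v : V) (w : W), f v (op t • w) = op t • f v w) : tensor V W ⟶ X where
  hom := liftAdd f hb
  map_left r x := by
    induction x using tensor_induction with
    | zero => simp
    | tmul v w => exact hl r v w
    | add x y hx hy => rw [smul_add, map_add, map_add, smul_add, hx, hy]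
  map_right t x := by
    induction x using tensor_induction with
    | zero => simp
    | tmul v w => exact hr t v w
    | add x y hx hy => rw [smul_add, map_add, map_add, smul_add, hx, hy]

@[simp] lemma lift_tmul {X : FieldBimodule R T} (f : V →+ W →+ X) (hb) (hl) (hr) (v : V) (w : W) :
    (lift f hb hl hr : tensor V W ⟶ X).hom (tmul v w) = f v w := rfl

lemma tensor_ext {X : FieldBimodule R T} {f g : tensor V W ⟶ X}
    (h : ∀ v w, f.hom (tmul v w) = g.hom (tmul v w)) : f = g :=
  hom_ext fun x => by
    induction x using tensor_induction with
    | zero => simp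
    | tmul v w => exact h v w
    | add x y hx hy => rw [map_add, map_add, hx, hy]

end tmul

/-- The pure tensor map, as a biadditive map. -/
noncomputable def tmulHom (V : FieldBimodule R S) (W : FieldBimodule S T) : V →+ W →+ tensor V W :=
  AddMonoidHom.mk' (fun v => AddMonoidHom.mk' (fun w => tmul v w) (tmul_add v))
    fun v v' => AddMonoidHom.ext fun w => add_tmul v v' w

@[simp] lemma tmulHom_apply {V : FieldBimodule R S} {W : FieldBimodule S T} (v : V) (w : W) :
    tmulHom V W v w = tmul v w := rfl

/-- The tensor product of two homomorphisms. -/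
noncomputable def tensorMap {V V' : FieldBimodule R S} {W W' : FieldBimodule S T}
    (f : V ⟶ V') (g : W ⟶ W') : tensor V W ⟶ tensor V' W' :=
  lift (((tmulHom V' W').compl₂ g.hom).comp f.hom)
    (fun s v w => by simp [f.map_right, g.map_left, balanced])
    (fun r v w => by simp [f.map_left, smul_tmul_left])
    (fun t v w => by simp [g.map_right, smul_tmul_right])

@[simp] lemma tensorMap_tmul {V V' : FieldBimodule R S} {W W' : FieldBimodule S T}
    (f : V ⟶ V') (g : W ⟶ W') (v : V) (w : W) :
    (tensorMap f g).hom (tmul v w) = tmul (f.hom v) (g.hom w) := rfl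

section associator

variable (V : FieldBimodule R S) (W : FieldBimodule S T) (X : FieldBimodule T U)

/-- The associativity map, `(v ⊗ w) ⊗ x ↦ v ⊗ (w ⊗ x)`. -/
noncomputable def assocHom : tensor (tensor V W) X ⟶ tensor V (tensor W X) :=
  lift
    (liftAdd
      (AddMonoidHom.mk' (fun v => (AddMonoidHom.compHom (tmulHom V (tensor W X) v)).comp
          (tmulHom W X))
        fun v v' => by ext w x; simp)
      fun s v w => by ext x; simp [balanced, smul_tmul_left])
    (fun t y x => by
      induction y using tensor_induction with
      | zero => simp
      | tmul v w => simp [balanced, smul_tmul_right]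
      | add y y' h h' => simp only [smul_add, map_add, AddMonoidHom.add_apply, h, h'])
    (fun r y x => by
      induction y using tensor_induction with
      | zero => simp
      | tmul v w => simp [smul_tmul_left]
      | add y y' h h' => simp only [smul_add, map_add, AddMonoidHom.add_apply, h, h'])
    (fun t y x => by
      induction y using tensor_induction with
      | zero => simp
      | tmul v w => simp [smul_tmul_right]
      | add y y' h h' => simp only [smul_add, map_add, AddMonoidHom.add_apply, h, h'])

/-- The map `w ⊗ x ↦ (v ⊗ w) ⊗ x` for fixed `v`. -/
noncomputable def assocInvAux (v : V) : tensor W X →+ tensor (tensor V W) X :=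
  liftAdd ((tmulHom (tensor V W) X).comp (tmulHom V W v))
    fun s w x => by simp [balanced, ← smul_tmul_right]

@[simp] lemma assocInvAux_tmul (v : V) (w : W) (x : X) :
    assocInvAux V W X v (tmul w x) = tmul (tmul v w) x := rfl

/-- The inverse associativity map, `v ⊗ (w ⊗ x) ↦ (v ⊗ w) ⊗ x`. -/
noncomputable def assocInv : tensor V (tensor W X) ⟶ tensor (tensor V W) X :=
  lift
    (AddMonoidHom.mk' (assocInvAux V W X) fun v v' => by
        ext y
        induction y using tensor_induction with
        | zero => simp
        | tmul w x => simp [add_tmul]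
        | add y y' h h' => simp only [map_add, h, h'])
    (fun t v y => by
      induction y using tensor_induction with
      | zero => simp
      | tmul v w => simp [balanced, smul_tmul_left]
      | add y y' h h' => simp only [smul_add, map_add, h, h'])
    (fun r v y => by
      induction y using tensor_induction with
      | zero => simp
      | tmul v w => simp [smul_tmul_left]
      | add y y' h h' => simp only [smul_add, map_add, h, h'])
    (fun t v y => by
      induction y using tensor_induction with
      | zero => simp
      | tmul v w => simp [smul_tmul_right]
      | add y y' h h' => simp only [smul_add, map_add, h, h'])

@[simp] lemma assocHom_tmul (v : V) (w : W) (x : X) :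
    (assocHom V W X).hom (tmul (tmul v w) x) = tmul v (tmul w x) := rfl

@[simp] lemma assocInv_tmul (v : V) (w : W) (x : X) :
    (assocInv V W X).hom (tmul v (tmul w x)) = tmul (tmul v w) x := rfl

variable {V W X}

lemma tensor_ext₃ {Y : FieldBimodule R U} {f g : tensor (tensor V W) X ⟶ Y}
    (h : ∀ v w x, f.hom (tmul (tmul v w) x) = g.hom (tmul (tmul v w) x)) : f = g :=
  tensor_ext fun y x => by
    induction y using tensor_induction with
    | zero =>
      have h0 : tmul (0 : tensor V W) x = 0 := by simp [← tmulHom_apply]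
      rw [h0, map_zero, map_zero]
    | tmul v w => exact h v w x
    | add y y' hy hy' => rw [add_tmul, map_add, map_add, hy, hy']

lemma tensor_ext₃' {Y : FieldBimodule R U} {f g : tensor V (tensor W X) ⟶ Y}
    (h : ∀ v w x, f.hom (tmul v (tmul w x)) = g.hom (tmul v (tmul w x))) : f = g :=
  tensor_ext fun v y => by
    induction y using tensor_induction with
    | zero =>
      have h0 : tmul v (0 : tensor W X) = 0 := by simp [← tmulHom_apply]
      rw [h0, map_zero, map_zero]
    | tmul w x => exact h v w x
    | add y y' hy hy' => rw [tmul_add, map_add, map_add, hy, hy']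

lemma tensor_ext₄ {R' : Type u} [Field R'] {V' : FieldBimodule R' R} {Y : FieldBimodule R' U}
    {f g : tensor (tensor (tensor V' V) W) X ⟶ Y}
    (h : ∀ v' v w x, f.hom (tmul (tmul (tmul v' v) w) x) =
      g.hom (tmul (tmul (tmul v' v) w) x)) : f = g :=
  tensor_ext₃ fun y w x => by
    induction y using tensor_induction with
    | zero =>
      have h0 : tmul (0 : tensor V' V) w = 0 := by simp [← tmulHom_apply]
      have h1 : tmul (0 : tensor (tensor V' V) W) x = 0 := by simp [← tmulHom_apply]
      rw [h0, h1, map_zero, map_zero]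
    | tmul v' v => exact h v' v w x
    | add y y' hy hy' => rw [add_tmul, add_tmul, map_add, map_add, hy, hy']

variable (V W X)

/-- The associator. -/
noncomputable def assoc : tensor (tensor V W) X ≅ tensor V (tensor W X) where
  hom := assocHom V W X
  inv := assocInv V W X
  hom_inv_id := tensor_ext₃ fun _ _ _ => rfl
  inv_hom_id := tensor_ext₃' fun _ _ _ => rfl

end associator

/-- The identity bimodule. -/
def unit (R : Type u) [Field R] : FieldBimodule R R where
  carrier := R

/-- The element `r` of the identity bimodule. -/
def unitMk (r : R) : unit R := r

lemma smul_unitMk (r s : R) : r • unitMk s = unitMk (r * s) := rfl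

lemma op_smul_unitMk (r s : R) : op r • unitMk s = unitMk (s * r) := rfl

/-- The left unitor, `r ⊗ v ↦ r • v`. -/
noncomputable def leftUnitor (V : FieldBimodule R S) : tensor (unit R) V ≅ V where
  hom := lift
    (AddMonoidHom.mk' (fun r : unit R => DistribSMul.toAddMonoidHom V (show R from r))
      fun r r' => by ext v; exact add_smul (show R from r) (show R from r') v)
    (fun s r v => mul_smul (show R from r) s v)
    (fun s r v => mul_smul s (show R from r) v)
    (fun t r v => smul_comm (show R from r) (op t) v)
  inv :=
    { hom := tmulHom (unit R) V (unitMk 1)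
      map_left := fun r v => by
        simp only [tmulHom_apply, smul_tmul_left, ← balanced, smul_unitMk, op_smul_unitMk,
          mul_one, one_mul]
      map_right := fun s v => rfl }
  hom_inv_id := tensor_ext fun r v => by
    change tmul (unitMk 1) ((show R from r) • v) = tmul r v
    rw [← balanced, op_smul_unitMk, one_mul]; rfl
  inv_hom_id := hom_ext fun v => one_smul R v

/-- The right unitor, `v ⊗ s ↦ v • s`. -/
noncomputable def rightUnitor (V : FieldBimodule R S) : tensor V (unit S) ≅ V where
  hom := lift
    (AddMonoidHom.flip <| AddMonoidHom.mk'
      (fun s : unit S => DistribSMul.toAddMonoidHom V (op (show S from s)))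
      fun s s' => by ext v; exact add_smul (op (show S from s)) (op (show S from s')) v)
    (fun s v s' => by
      change op (show S from s') • op s • v = op (s * (show S from s')) • v
      rw [← mul_smul, ← op_mul])
    (fun r v s => (smul_comm r (op (show S from s)) v).symm)
    (fun t v s => by
      change op ((show S from s) * t) • v = op t • op (show S from s) • v
      rw [← mul_smul, ← op_mul])
  inv :=
    { hom := (tmulHom V (unit S)).flip (unitMk 1)
      map_left := fun r v => rfl
      map_right := fun s v => by
        simp only [AddMonoidHom.flip_apply, tmulHom_apply, smul_tmul_right, balanced, smul_unitMk,
          op_smul_unitMk, mul_one, one_mul] }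
  hom_inv_id := tensor_ext fun v s => by
    change tmul (op (show S from s) • v) (unitMk 1) = tmul v s
    rw [balanced, smul_unitMk, mul_one]; rfl
  inv_hom_id := hom_ext fun v => one_smul Sᵐᵒᵖ v

@[simp] lemma leftUnitor_hom_tmul (V : FieldBimodule R S) (r : R) (v : V) :
    V.leftUnitor.hom.hom (tmul (unitMk r) v) = r • v := rfl

@[simp] lemma leftUnitor_inv_apply (V : FieldBimodule R S) (v : V) :
    V.leftUnitor.inv.hom v = tmul (unitMk 1) v := rfl

@[simp] lemma rightUnitor_hom_tmul (V : FieldBimodule R S) (v : V) (s : S) :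
    V.rightUnitor.hom.hom (tmul v (unitMk s)) = op s • v := rfl

@[simp] lemma rightUnitor_inv_apply (V : FieldBimodule R S) (v : V) :
    V.rightUnitor.inv.hom v = tmul v (unitMk 1) := rfl

/-! ### Composita -/

/-- The embedding of `R` in the endomorphism ring of a bimodule by left multiplication. -/
def leftScalar (V : FieldBimodule R S) : R →+* End V where
  toFun r :=
    { hom := DistribSMul.toAddMonoidHom V r
      map_left := fun r' v => smul_comm r r' v
      map_right := fun s v => smul_comm r (op s) v }
  map_one' := hom_ext fun v => one_smul R v
  map_mul' r r' := hom_ext fun v => mul_smul r r' v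
  map_zero' := hom_ext fun v => zero_smul R v
  map_add' r r' := hom_ext fun v => add_smul r r' v

/-- The embedding of `S` in the endomorphism ring of a bimodule by right multiplication. -/
def rightScalar (V : FieldBimodule R S) : S →+* End V where
  toFun s :=
    { hom := DistribSMul.toAddMonoidHom V (op s)
      map_left := fun r v => (smul_comm r (op s) v).symm
      map_right := fun s' v => smul_comm (op s) (op s') v }
  map_one' := hom_ext fun v => one_smul Sᵐᵒᵖ v
  map_mul' s s' := hom_ext fun v => by
    change op (s * s') • v = op s • op s' • v
    rw [mul_comm, op_mul, mul_smul]
  map_zero' := hom_ext fun v => zero_smul Sᵐᵒᵖ v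
  map_add' s s' := hom_ext fun v => add_smul (op s) (op s') v

/-- The compositum `k_V` of `R` and `S` in `End V`: the subring generated by the left and the right
multiplications. When `End V` is a division ring that is finite-dimensional over `R`,
this is the subfield generated by them. -/
def compositum (V : FieldBimodule R S) : Subring (End V) :=
  Subring.closure (Set.range V.leftScalar ∪ Set.range V.rightScalar)

/-- The compositum `k_V` is separable over both `R` and `S`: each of its elements is a root of
a separable polynomial over `R` and of one over `S`. -/
def IsBiseparable (V : FieldBimodule R S) : Prop :=
  ∀ x ∈ V.compositum,
    (∃ p : Polynomial R, p.Separable ∧ p.eval₂ V.leftScalar x = 0) ∧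
    (∃ q : Polynomial S, q.Separable ∧ q.eval₂ V.rightScalar x = 0)

end FieldBimodule

/-! ### The 2-category of bimodules over a family of fields -/

/-- The objects of the 2-category `K-Mod-K`: the members of the family `K`. -/
structure KModK {ι : Type w} (K : ι → Type u) [∀ i, Field (K i)] : Type w where
  /-- The index of the field. -/
  index : ι

namespace KModK

variable {ι : Type w} (K : ι → Type u) [∀ i, Field (K i)]

/-- 1-morphisms `A ⟶ B` are `K A.index`-`K B.index`-bimodules, 2-morphisms are bimodule homomorphisms, and
the composition of 1-morphisms is the tensor product over the middle field. -/
noncomputable instance : Bicategory (KModK K) where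
  Hom A B := FieldBimodule (K A.index) (K B.index)
  id A := FieldBimodule.unit (K A.index)
  comp V W := FieldBimodule.tensor V W
  homCategory A B := inferInstanceAs (Category (FieldBimodule (K A.index) (K B.index)))
  whiskerLeft V _ _ f := FieldBimodule.tensorMap (𝟙 V) f
  whiskerRight f W := FieldBimodule.tensorMap f (𝟙 W)
  associator V W X := FieldBimodule.assoc V W X
  leftUnitor V := FieldBimodule.leftUnitor V
  rightUnitor V := FieldBimodule.rightUnitor V
  whiskerLeft_id _ _ := FieldBimodule.tensor_ext fun _ _ => rfl
  whiskerLeft_comp _ _ _ _ _ _ := FieldBimodule.tensor_ext fun _ _ => rfl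
  id_whiskerLeft f := by
    rw [← Category.assoc, Iso.eq_comp_inv]
    exact FieldBimodule.tensor_ext fun r v => (f.map_left r v).symm
  comp_whiskerLeft _ _ _ _ _ := FieldBimodule.tensor_ext₃ fun _ _ _ => rfl
  id_whiskerRight _ _ := FieldBimodule.tensor_ext fun _ _ => rfl
  comp_whiskerRight _ _ _ := FieldBimodule.tensor_ext fun _ _ => rfl
  whiskerRight_id f := by
    rw [← Category.assoc, Iso.eq_comp_inv]
    exact FieldBimodule.tensor_ext fun v s => (f.map_right s v).symm
  whiskerRight_comp _ _ _ := FieldBimodule.tensor_ext₃' fun _ _ _ => rfl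
  whisker_assoc _ _ _ _ _ := FieldBimodule.tensor_ext₃ fun _ _ _ => rfl
  whisker_exchange _ _ := FieldBimodule.tensor_ext fun _ _ => rfl
  pentagon _ _ _ _ := FieldBimodule.tensor_ext₄ fun _ _ _ _ => rfl
  triangle {_ B _} _ _ := FieldBimodule.tensor_ext₃ fun v s w =>
    (FieldBimodule.balanced (show K B.index from s) v w).symm

instance (A B : KModK K) : Preadditive (A ⟶ B) :=
  inferInstanceAs (Preadditive (FieldBimodule (K A.index) (K B.index)))

end KModK

/-! ### Sub-2-categories -/

/-- A full sub-2-category of a 2-category `C`, on all the objects of `C`: a class of 1-morphisms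
that contains the identities and is closed under composition, together with all the 2-morphisms
of `C` between them. -/
structure FullSubTwoCategory (C : Type w) [Bicategory.{u, v} C] where
  /-- The class of 1-morphisms. -/
  mem : ∀ A B : C, ObjectProperty (A ⟶ B)
  id_mem : ∀ A : C, mem A A (𝟙 A)
  comp_mem : ∀ {A B E : C} (V : A ⟶ B) (W : B ⟶ E), mem A B V → mem B E W → mem A E (V ≫ W)

namespace FullSubTwoCategory

variable {C : Type w} [Bicategory.{u, v} C]

/-- The objects of a full sub-2-category. -/
structure Obj (D : FullSubTwoCategory C) : Type w where
  /-- The object of the ambient 2-category. -/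
  base : C

open Bicategory in
instance (D : FullSubTwoCategory C) : Bicategory D.Obj where
  Hom A B := (D.mem A.base B.base).FullSubcategory
  id A := ⟨𝟙 A.base, D.id_mem A.base⟩
  comp V W := ⟨V.obj ≫ W.obj, D.comp_mem V.obj W.obj V.property W.property⟩
  homCategory A B := inferInstanceAs (Category (D.mem A.base B.base).FullSubcategory)
  whiskerLeft V _ _ f := ObjectProperty.homMk (V.obj ◁ f.hom)
  whiskerRight f W := ObjectProperty.homMk (f.hom ▷ W.obj)
  associator V W X := ObjectProperty.isoMk _ (α_ V.obj W.obj X.obj)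
  leftUnitor V := ObjectProperty.isoMk _ (λ_ V.obj)
  rightUnitor V := ObjectProperty.isoMk _ (ρ_ V.obj)
  whiskerLeft_id _ _ := ObjectProperty.hom_ext _ (Bicategory.whiskerLeft_id _ _)
  whiskerLeft_comp _ _ _ _ _ _ := ObjectProperty.hom_ext _ (Bicategory.whiskerLeft_comp _ _ _)
  id_whiskerLeft _ := ObjectProperty.hom_ext _ (Bicategory.id_whiskerLeft _)
  comp_whiskerLeft _ _ _ _ _ := ObjectProperty.hom_ext _ (Bicategory.comp_whiskerLeft _ _ _)
  id_whiskerRight _ _ := ObjectProperty.hom_ext _ (Bicategory.id_whiskerRight _ _)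
  comp_whiskerRight _ _ _ := ObjectProperty.hom_ext _ (Bicategory.comp_whiskerRight _ _ _)
  whiskerRight_id _ := ObjectProperty.hom_ext _ (Bicategory.whiskerRight_id _)
  whiskerRight_comp _ _ _ := ObjectProperty.hom_ext _ (Bicategory.whiskerRight_comp _ _ _)
  whisker_assoc _ _ _ _ _ := ObjectProperty.hom_ext _ (Bicategory.whisker_assoc _ _ _)
  whisker_exchange _ _ := ObjectProperty.hom_ext _ (Bicategory.whisker_exchange _ _)
  pentagon _ _ _ _ := ObjectProperty.hom_ext _ (Bicategory.pentagon _ _ _ _)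
  triangle _ _ := ObjectProperty.hom_ext _ (Bicategory.triangle _ _)

instance [∀ A B : C, Preadditive (A ⟶ B)] (D : FullSubTwoCategory C) (A B : D.Obj) :
    Preadditive (A ⟶ B) :=
  inferInstanceAs (Preadditive (D.mem A.base B.base).FullSubcategory)

end FullSubTwoCategory

/-! ### Properties of 2-categories -/

/-- A preadditive category is abelian and semisimple: it is abelian, and every object is a direct
sum of finitely many simple objects. -/
structure IsSemisimpleAbelian (C : Type v) [Category.{u} C] [Preadditive C] : Prop where
  hasFiniteProducts : Limits.HasFiniteProducts C
  hasKernels : Limits.HasKernels C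
  hasCokernels : Limits.HasCokernels C
  isNormalMonoCategory : IsNormalMonoCategory C
  isNormalEpiCategory : IsNormalEpiCategory C
  exists_decomposition : ∀ X : C, ∃ (n : ℕ) (Y : Fin n → C) (b : Limits.Bicone Y),
    (∀ i, Simple (Y i)) ∧ Nonempty b.IsBilimit ∧ Nonempty (X ≅ b.pt)

section TwoCategory

variable (C : Type w) [Bicategory.{u, v} C]

open Bicategory in
/-- Every 1-morphism `V` has a right dual `V*`, with maps `1 ⟶ V ⊗ V*` and `V* ⊗ V ⟶ 1`, and a
left dual `*V`, with maps `1 ⟶ *V ⊗ V` and `V ⊗ *V ⟶ 1`, satisfying the triangle identities. -/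
def IsRigid : Prop :=
  ∀ ⦃A B : C⦄ (V : A ⟶ B),
    (∃ W : B ⟶ A, Nonempty (V ⊣ W)) ∧ (∃ W : B ⟶ A, Nonempty (W ⊣ V))

/-- Any two objects are linked by a chain of nonzero 1-morphisms, in either direction. -/
def IsConnectedTwoCategory : Prop :=
  ∀ A B : C, Relation.EqvGen (fun A B : C => ∃ V : A ⟶ B, ¬ Limits.IsZero V) A B

variable [∀ A B : C, Preadditive (A ⟶ B)]

/-- Each category of 1-morphisms is abelian and semisimple. -/
def IsSemisimpleTwoCategory : Prop := ∀ A B : C, IsSemisimpleAbelian (A ⟶ B)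

/-- There are, up to isomorphism, only finitely many simple 1-morphisms between any two objects. -/
def HasFinitelyManySimples : Prop :=
  ∀ A B : C, ∃ s : Set (A ⟶ B), s.Finite ∧ ∀ V : A ⟶ B, Simple V → ∃ W ∈ s, Nonempty (V ≅ W)

end TwoCategory

/-! ### Forgetful functors -/

namespace FullSubTwoCategory

variable {ι : Type w} {K : ι → Type u} [∀ i, Field (K i)] (D : FullSubTwoCategory (KModK K))

variable {D}

/-- The bimodule underlying a 1-morphism. -/
abbrev bimodule {A B : D.Obj} (V : A ⟶ B) : FieldBimodule (K A.base.index) (K B.base.index) :=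
  V.obj

/-- The bimodule homomorphism underlying a 2-morphism. -/
abbrev bimoduleHom {A B : D.Obj} {V W : A ⟶ B} (f : V ⟶ W) : bimodule V ⟶ bimodule W :=
  f.hom

variable (D)

/-- All simple 1-morphisms have biseparable composita. -/
def HasNoInseparableExtensions : Prop :=
  ∀ ⦃A B : D.Obj⦄ (V : A ⟶ B), Simple V → (bimodule V).IsBiseparable

variable {D}

section Lax

variable {k : Type u} [Field k] (F : LaxFunctor D.Obj (MonoidalSingleObj (FGModuleCat.{u} k)))

/-- The vector space assigned to a 1-morphism. -/
abbrev vectorSpace {A B : D.Obj} (V : A ⟶ B) : FGModuleCat.{u} k := F.map V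

/-- The linear map assigned to a 2-morphism. -/
abbrev linearMap {A B : D.Obj} {V W : A ⟶ B} (f : V ⟶ W) :
    vectorSpace F V →ₗ[k] vectorSpace F W :=
  (show vectorSpace F V ⟶ vectorSpace F W from F.map₂ f).hom.hom

open MonoidalCategory in
/-- The lax unit constraint, as a linear map. -/
noncomputable abbrev unitMap (A : D.Obj) : k →ₗ[k] vectorSpace F (𝟙 A) :=
  (show 𝟙_ (FGModuleCat.{u} k) ⟶ vectorSpace F (𝟙 A) from F.mapId A).hom.hom

open MonoidalCategory in
/-- The lax composition constraint, as a linear map. -/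
noncomputable abbrev compMap {A B E : D.Obj} (V : A ⟶ B) (W : B ⟶ E) :
    vectorSpace F V ⊗[k] vectorSpace F W →ₗ[k] vectorSpace F (V ≫ W) :=
  (show vectorSpace F V ⊗ vectorSpace F W ⟶ vectorSpace F (V ≫ W) from F.mapComp V W).hom.hom

end Lax

variable (D)

/-- A forgetful functor from a 2-category `D` of bimodules to finite-dimensional `k`-vector
spaces, relative to embeddings `β` of `k` in the fields: a lax functor to the monoidal category of
finite-dimensional `k`-vector spaces that keeps the underlying abelian group of each bimodule `V`
and the underlying map of each homomorphism. The field `k` acts on `V` through `β` on the left, and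
equally through `β` on the right; the lax constraints are `β : k → K A` and the canonical
projections `V ⊗_k W → V ⊗_B W`. -/
structure ForgetfulFunctor (k : Type u) [Field k] (β : ∀ i, k →+* K i) where
  /-- The underlying lax functor. -/
  functor : LaxFunctor D.Obj (MonoidalSingleObj (FGModuleCat.{u} k))
  /-- The identification of the underlying abelian groups. -/
  iso : ∀ {A B : D.Obj} (V : A ⟶ B), bimodule V ≃+ vectorSpace functor V
  iso_left : ∀ {A B : D.Obj} (V : A ⟶ B) (c : k) (v : bimodule V),
    iso V (β A.base.index c • v) = c • iso V v
  iso_right : ∀ {A B : D.Obj} (V : A ⟶ B) (c : k) (v : bimodule V),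
    iso V (op (β B.base.index c) • v) = c • iso V v
  iso_naturality : ∀ {A B : D.Obj} {V W : A ⟶ B} (f : V ⟶ W) (v : bimodule V),
    iso W ((bimoduleHom f).hom v) = linearMap functor f (iso V v)
  unitMap_apply : ∀ (A : D.Obj) (c : k),
    unitMap functor A c = iso (𝟙 A) (FieldBimodule.unitMk (β A.base.index c))
  compMap_tmul : ∀ {A B E : D.Obj} (V : A ⟶ B) (W : B ⟶ E) (v : bimodule V) (w : bimodule W),
    compMap functor V W (iso V v ⊗ₜ[k] iso W w) = iso (V ≫ W) (FieldBimodule.tmul v w)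

end FullSubTwoCategory

/-!
The field `k` is the center of `D`: the families of scalars `x A` in `k_A` such that
`x A • v = v • x B` for all `v` in all bimodules `V ∈ D(A, B)`. By connectedness a central family
that vanishes at one object vanishes everywhere, so the center is a field that embeds in every
`k_A`; `k` is its image in one of them. By construction the left and the right action of `k` agree
on every bimodule, which makes the projections `V ⊗_k W → V ⊗_B W` well defined, and the laws of a
lax functor hold on pure tensors by definition.

The substance is that `k_B` is finite over `k`. It follows from an independence theorem in the
manner of Dedekind and Artin, `FieldBimodule.IsConnectedClass.eq_zero_of_relation`: if the scalars
`b_x ∈ k_B` are linearly independent over the center, then no nontrivial relation `∑ a_x v b_x = 0`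
holds for all `V ∈ D(A, B)` and `v ∈ V`. Tensoring with nonzero bimodules and contracting with
functionals carries a relation from one object `A` to all others, with some coefficient normalized
to one. For `v` in `V ∈ D(A', A)` and `w` in `W ∈ D(A, B)`, the relations `a'` out of `A'` and `a`
out of `A` give `∑ (a'_x v - v a_x) ⊗ w b_x = 0`, which has fewer terms; so by induction
`a'_x v = v a_x`. The coefficients are therefore central, and the relation on the identity bimodule
of `B` contradicts the independence of the `b_x`.

By semisimplicity, relations that hold for every `V ∈ D(B, B)` are detected by the finitely many
simple ones, and rigidity makes these finite-dimensional over `k_B` on the left: the unit of an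
adjunction is a finite sum of tensors, and the triangle identities expand every vector in terms of
these (`FullSubTwoCategory.exists_dual_bases`). Thus the operators `v ↦ a v b` span a subspace of the product
of finitely many finite-dimensional endomorphism spaces, and this bounds the number of independent
`b_x`.
-/

namespace FieldBimodule

/-! ### Contraction of tensor products -/

section Contraction

variable {R S T : Type u} [Field R] [Field S] [Field T]

lemma functional_op_smul {V : FieldBimodule R S} (φ : V.RightMod →ₗ[S] S) (s : S) (v : V) :
    φ (op s • v : V) = s * φ v :=
  φ.map_smul s v

lemma exists_functional_eq_one {V : FieldBimodule R S} {v : V} (hv : v ≠ 0) :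
    ∃ φ : V.RightMod →ₗ[S] S, φ v = 1 := by
  let v' : V.RightMod := v
  obtain ⟨φ, hφ⟩ : ∃ φ : V.RightMod →ₗ[S] S, φ v' ≠ 0 := by
    by_contra! h
    exact hv ((Module.forall_dual_apply_eq_zero_iff S v').1 h)
  exact ⟨(φ v')⁻¹ • φ, inv_mul_cancel₀ hφ⟩

/-- Contraction of the left factor of `V ⊗_S W` with a right-linear functional `φ` on `V`,
`v ⊗ w ↦ φ v • w`. -/
noncomputable def contract {V : FieldBimodule R S} (φ : V.RightMod →ₗ[S] S)
    (W : FieldBimodule S T) : tensor V W →+ W :=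
  liftAdd
    (AddMonoidHom.mk' (fun v : V => DistribSMul.toAddMonoidHom W (φ v)) fun v v' => by
      ext w
      exact (congrArg (· • w) (φ.map_add v v')).trans (add_smul _ _ _))
    fun s v w => by
      change φ (op s • v : V) • w = φ v • s • w
      rw [functional_op_smul, mul_comm, mul_smul]

@[simp] lemma contract_tmul {V : FieldBimodule R S} (φ : V.RightMod →ₗ[S] S)
    {W : FieldBimodule S T} (v : V) (w : W) : contract φ W (tmul v w) = φ v • w := rfl

lemma tmul_ne_zero {V : FieldBimodule R S} {W : FieldBimodule S T} {v : V} {w : W}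
    (hv : v ≠ 0) (hw : w ≠ 0) : tmul v w ≠ 0 := fun h => by
  obtain ⟨φ, hφ⟩ := exists_functional_eq_one hv
  have := congrArg (contract φ W) h
  rw [contract_tmul, hφ, one_smul, map_zero] at this
  exact hw this

end Contraction

/-! ### The center of a class of bimodules -/

section Center

variable {ι : Type w} {K : ι → Type u} [∀ i, Field (K i)]
  (M : ∀ i j, Set (FieldBimodule (K i) (K j)))

/-- The families of scalars that act in the same way from the left and from the right on every
bimodule of the class `M`. -/
def center : Subring (∀ i, K i) where
  carrier := {x | ∀ i j, ∀ V ∈ M i j, ∀ v : V, x i • v = op (x j) • v}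
  zero_mem' i j V _ v := by simp
  one_mem' i j V _ v := by simp
  add_mem' hx hy i j V hV v := by
    simp only [Pi.add_apply, MulOpposite.op_add, add_smul, hx i j V hV v, hy i j V hV v]
  mul_mem' {x y} hx hy i j V hV v := by
    rw [Pi.mul_apply, Pi.mul_apply, mul_smul, hy i j V hV, hx i j V hV, ← mul_smul, op_mul,
      ← op_mul, ← op_mul, mul_comm]
  neg_mem' hx i j V hV v := by
    simp only [Pi.neg_apply, MulOpposite.op_neg, neg_smul, hx i j V hV v]

/-- A class of bimodules that contains the identities, is closed under composition, and has a
nonzero member from every object to every other. -/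
structure IsConnectedClass : Prop where
  unit_mem : ∀ i, unit (K i) ∈ M i i
  tensor_mem : ∀ {i j l} {V : FieldBimodule (K i) (K j)} {W : FieldBimodule (K j) (K l)},
    V ∈ M i j → W ∈ M j l → tensor V W ∈ M i l
  exists_ne_zero : ∀ i j, ∃ V ∈ M i j, ∃ v : V, v ≠ 0

variable {M}

namespace IsConnectedClass

lemma eq_zero_of_apply_eq_zero (hM : IsConnectedClass M) {x : ∀ i, K i} (hx : x ∈ center M)
    {i : ι} (hi : x i = 0) : x = 0 := by
  funext j
  obtain ⟨V, hV, v, hv⟩ := hM.exists_ne_zero i j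
  have := hx i j V hV v
  rw [hi, zero_smul, eq_comm, smul_eq_zero] at this
  exact op_injective (this.resolve_right hv)

lemma isField_center (hM : IsConnectedClass M) [Nonempty ι] : IsField (center M) where
  exists_pair_ne := ⟨0, 1, fun h => by
    obtain ⟨i⟩ := ‹Nonempty ι›
    exact zero_ne_one (congrFun (congrArg Subtype.val h) i)⟩
  mul_comm := mul_comm
  mul_inv_cancel := by
    rintro ⟨x, hx⟩ h0
    have hne : ∀ i, x i ≠ 0 := fun i hi =>
      h0 (Subtype.ext (hM.eq_zero_of_apply_eq_zero hx hi))
    refine ⟨⟨fun i => (x i)⁻¹, fun i j V hV v => ?_⟩,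
      Subtype.ext (funext fun i => mul_inv_cancel₀ (hne i))⟩
    rw [inv_smul_eq_iff₀ (hne i), smul_comm, hx i j V hV, ← mul_smul, ← op_mul,
      mul_inv_cancel₀ (hne j), op_one, one_smul]

/-- A relation among the operators `v ↦ a • v • b` on the bimodules out of `i` yields one, with the
same right coefficients, on the bimodules out of any other object; a nonzero left coefficient can be
normalized to one. -/
lemma exists_relation (hM : IsConnectedClass M) {j : ι} {κ : Type*} {b : κ → K j} {s : Finset κ}
    {i : ι} {a : κ → K i}
    (ha : ∀ V ∈ M i j, ∀ v : V, ∑ x ∈ s, a x • op (b x) • v = 0) {y : κ} (hy : a y ≠ 0) (l : ι) :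
    ∃ a' : κ → K l, a' y = 1 ∧ ∀ V ∈ M l j, ∀ v : V, ∑ x ∈ s, a' x • op (b x) • v = 0 := by
  obtain ⟨V, hV, v, hv⟩ := hM.exists_ne_zero i l
  obtain ⟨φ, hφ⟩ := exists_functional_eq_one (smul_ne_zero hy hv)
  refine ⟨fun x => φ (a x • v : V), hφ, fun W hW w => ?_⟩
  have h := congrArg (contract φ W) (ha _ (hM.tensor_mem hV hW) (tmul v w))
  simpa only [smul_tmul_right, smul_tmul_left, map_sum, contract_tmul, map_zero] using h

/-- Scalars `b x` that are linearly independent over the center give right multiplications that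
are linearly independent over left multiplications. The argument is that of Dedekind and Artin: two
relations, on the bimodules out of `i` and out of `l`, both with coefficient one at the same place,
are compared on `V ⊗ W`, and their difference is a shorter relation. -/
theorem eq_zero_of_relation (hM : IsConnectedClass M) {j : ι} {κ : Type*} (b : κ → K j)
    (s : Finset κ)
    (hb : ∀ c : κ → ∀ i, K i, (∀ x ∈ s, c x ∈ center M) → ∑ x ∈ s, c x j * b x = 0 →
      ∀ x ∈ s, c x = 0)
    {i : ι} (a : κ → K i) (ha : ∀ V ∈ M i j, ∀ v : V, ∑ x ∈ s, a x • op (b x) • v = 0) :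
    ∀ x ∈ s, a x = 0 := by
  classical
  induction s using Finset.induction_on generalizing i with
  | empty => simp
  | insert y s hys ih =>
    have hne : ∀ x ∈ s, x ≠ y := fun x hx h => hys (h ▸ hx)
    replace ih : ∀ {i : ι} (a : κ → K i),
        (∀ V ∈ M i j, ∀ v : V, ∑ x ∈ s, a x • op (b x) • v = 0) → ∀ x ∈ s, a x = 0 := by
      refine fun a => ih (fun c hc h x hx => ?_) a
      have := hb (Function.update c y 0) (fun z hz => ?_) ?_ x (Finset.mem_insert_of_mem hx)
      · rwa [Function.update_of_ne (hne x hx)] at this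
      · rcases Finset.mem_insert.1 hz with rfl | hz
        · simp [zero_mem]
        · rw [Function.update_of_ne (hne z hz)]; exact hc z hz
      · rw [Finset.sum_insert hys, Function.update_self, Pi.zero_apply, zero_mul, zero_add, ← h]
        exact Finset.sum_congr rfl fun z hz => by rw [Function.update_of_ne (hne z hz)]
    by_cases hay : a y = 0
    · intro x hx
      rcases Finset.mem_insert.1 hx with rfl | hx
      · exact hay
      · refine ih a (fun V hV v => ?_) x hx
        simpa [Finset.sum_insert hys, hay] using ha V hV v
    exfalso
    -- Normalized relations out of every object: their coefficients turn out to be central, so that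
    -- the relation on the identity bimodule contradicts the independence of the `b x`.
    choose c hcy hc using hM.exists_relation ha hay
    have key : ∀ x ∈ s, (fun l => c l x) ∈ center M := by
      intro x hx l m V hV v
      by_contra hne'
      rw [← sub_eq_zero] at hne'
      obtain ⟨φ, hφ⟩ := exists_functional_eq_one hne'
      refine one_ne_zero (hφ.symm.trans
        (ih (fun z => φ (c l z • v - op (c m z) • v : V)) (fun W hW w => ?_) x hx))
      -- `∑ c l z • v ⊗ w • b z` and `∑ v • c m z ⊗ w • b z` both vanish in `V ⊗ W`, and have the
      -- same term at `y`.
      have h₁ := hc l _ (hM.tensor_mem hV hW) (tmul v w)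
      have h₂ : ∑ z ∈ insert y s, tmul (op (c m z) • v) (op (b z) • w) = 0 := by
        simp only [balanced]
        simp only [← tmulHom_apply]
        rw [← map_sum, hc m W hW w, map_zero]
      simp only [smul_tmul_right, smul_tmul_left] at h₁
      have h₃ : ∑ z ∈ s, tmul (c l z • v - op (c m z) • v) (op (b z) • w) = 0 := by
        have h := (congrArg₂ (· - ·) h₁ h₂).trans (sub_zero 0)
        simp only [← tmulHom_apply] at h ⊢
        simp only [← Finset.sum_sub_distrib, ← AddMonoidHom.sub_apply, ← map_sub] at h
        rwa [Finset.sum_insert hys, hcy, hcy, op_one, one_smul, one_smul, sub_self, map_zero,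
          AddMonoidHom.zero_apply, zero_add] at h
      simpa only [map_sum, contract_tmul, map_zero] using congrArg (contract φ W) h₃
    have hcy' : (fun l => c l y) = (1 : ∀ i, K i) := funext hcy
    have := hb (fun x l => c l x) (fun x hx => ?_) ?_ y (Finset.mem_insert_self _ _)
    · exact one_ne_zero ((hcy j).symm.trans (congrFun this j))
    · rcases Finset.mem_insert.1 hx with rfl | hx
      · rw [hcy']; exact one_mem _
      · exact key x hx
    · have h := hc j _ (hM.unit_mem j) (unitMk 1)
      simp only [op_smul_unitMk, smul_unitMk, one_mul] at h
      exact h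

/-- Finiteness over the center, for any field `k` identified with it: the right multiplications by a
basis of `K j` over the center are linearly independent in the finite-dimensional space
`∏ t, End (W t)` of left-linear endomorphisms. -/
theorem finite_eval (hM : IsConnectedClass M) {k : Type u} [Field k] (e : k ≃+* center M)
    {j : ι} {τ : Type*} [Finite τ] (W : τ → FieldBimodule (K j) (K j))
    [∀ t, Module.Finite (K j) (W t)]
    (hW : ∀ {κ : Type u} (s : Finset κ) (a b : κ → K j),
      (∀ t, ∀ w : W t, ∑ x ∈ s, a x • op (b x) • w = 0) →
      ∀ V ∈ M j j, ∀ v : V, ∑ x ∈ s, a x • op (b x) • v = 0) :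
    (((Pi.evalRingHom K j).comp (center M).subtype).comp e.toRingHom).Finite := by
  classical
  let := (((Pi.evalRingHom K j).comp (center M).subtype).comp e.toRingHom).toAlgebra
  change Module.Finite k (K j)
  let B := Module.Basis.ofVectorSpace k (K j)
  let f (x : K j) : ∀ t, Module.End (K j) (W t) := fun t => (W t).rightEnd (op x)
  have hf : LinearIndependent (K j) (fun x => f (B x)) := by
    rw [linearIndependent_iff']
    intro s a h
    refine hM.eq_zero_of_relation B s (fun c hc h0 x hx => ?_) a (hW s a B fun t w => ?_)
    · let c' : _ → k := fun x => if hx : x ∈ s then e.symm ⟨c x, hc x hx⟩ else 0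
      have hc' : ∀ x (hx : x ∈ s), e (c' x) = ⟨c x, hc x hx⟩ := fun x hx => by simp [c', hx]
      have h1 : c' x = 0 := by
        refine linearIndependent_iff'.1 B.linearIndependent s c' ?_ x hx
        rw [← h0]
        refine Finset.sum_congr rfl fun z hz => ?_
        change (e (c' z)).1 j * B z = _
        rw [hc' z hz]
      have h2 := hc' x hx
      rw [h1, map_zero] at h2
      exact (congrArg Subtype.val h2).symm
    · have := congrArg (fun g => g t w) h
      simpa [f, rightEnd, LinearMap.sum_apply] using this
  have : Finite (Module.Basis.ofVectorSpaceIndex k (K j)) := hf.finite_of_isNoetherian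
  exact Module.Finite.of_basis B

end IsConnectedClass

end Center

end FieldBimodule

/-! ### Rigidity, connectedness and semisimplicity -/

namespace FullSubTwoCategory

variable {ι : Type w} {K : ι → Type u} [∀ i, Field (K i)] {D : FullSubTwoCategory (KModK K)}

open Bicategory

@[simp] lemma comp_bimoduleHom_apply {A B : D.Obj} {V W X : A ⟶ B} (f : V ⟶ W) (g : W ⟶ X)
    (v : bimodule V) :
    (bimoduleHom (f ≫ g)).hom v = (bimoduleHom g).hom ((bimoduleHom f).hom v) := rfl

/-- An adjunction `V ⊣ W` between bimodules gives dual generating systems of `V` and `W`: the image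
of `1` under the unit is a sum of tensors `p.1 ⊗ p.2`, `c` is the counit, and the expansions of `v`
and `w` are the two triangle identities. -/
lemma exists_dual_bases {A B : D.Obj} {V : A ⟶ B} {W : B ⟶ A} (adj : V ⊣ W) :
    ∃ (s : Finset (bimodule V × bimodule W)) (c : bimodule W → bimodule V → K B.base.index),
      (∀ v, c 0 v = 0) ∧ (∀ v, ∑ p ∈ s, op (c p.2 v) • p.1 = v) ∧
        ∀ w, ∑ p ∈ s, c w p.1 • p.2 = w := by
  have hl : adj.unit ▷ V ≫ (α_ V W V).hom ≫ V ◁ adj.counit ≫ (ρ_ V).hom = (λ_ V).hom := by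
    simpa [leftZigzag, bicategoricalComp] using adj.left_triangle =≫ (ρ_ V).hom
  have hr : W ◁ adj.unit ≫ (α_ W V W).inv ≫ adj.counit ▷ W ≫ (λ_ W).hom = (ρ_ W).hom := by
    simpa [rightZigzag, bicategoricalComp] using adj.right_triangle =≫ (λ_ W).hom
  let η : FieldBimodule.tensor (bimodule V) (bimodule W) :=
    (bimoduleHom adj.unit).hom (FieldBimodule.unitMk (1 : K A.base.index))
  obtain ⟨s, hs⟩ : ∃ s : Finset (bimodule V × bimodule W),
      η = ∑ p ∈ s, FieldBimodule.tmul p.1 p.2 :=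
    TensorProduct.exists_finset (R := K B.base.index) (M := (bimodule V).RightMod) η
  refine ⟨s, fun w v => (show FieldBimodule.unit (K B.base.index) from
    (bimoduleHom adj.counit).hom (FieldBimodule.tmul w v)), fun v => ?_, fun v => ?_, fun w => ?_⟩
  · refine (congrArg (bimoduleHom adj.counit).hom ?_).trans (map_zero _)
    exact congrFun (congrArg DFunLike.coe (map_zero (FieldBimodule.tmulHom _ _))) v
  · have h : (bimoduleHom ((α_ V W V).hom ≫ V ◁ adj.counit ≫ (ρ_ V).hom)).hom
        (FieldBimodule.tmul η v) = v :=
      (congrArg (fun f => (bimoduleHom f).hom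
        (FieldBimodule.tmul (FieldBimodule.unitMk (1 : K A.base.index)) v)) hl).trans
        (one_smul (K A.base.index) v)
    rw [hs, ← FieldBimodule.tmulHom_apply, map_sum, AddMonoidHom.finsetSum_apply, map_sum] at h
    exact h
  · have h : (bimoduleHom ((α_ W V W).inv ≫ adj.counit ▷ W ≫ (λ_ W).hom)).hom
        (FieldBimodule.tmul w η) = w :=
      (congrArg (fun f => (bimoduleHom f).hom
        (FieldBimodule.tmul w (FieldBimodule.unitMk (1 : K A.base.index)))) hr).trans
        (one_smul (K A.base.index)ᵐᵒᵖ w)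
    rw [hs, ← FieldBimodule.tmulHom_apply, map_sum, map_sum] at h
    exact h

lemma exists_ne_zero_of_not_isZero {A B : D.Obj} {V : A ⟶ B} (hV : ¬ Limits.IsZero V) :
    ∃ v : bimodule V, v ≠ 0 := by
  by_contra! h
  refine hV ((Limits.IsZero.iff_id_eq_zero V).2 ?_)
  exact ObjectProperty.hom_ext _ (FieldBimodule.hom_ext fun v => h v)

/-- A chain of nonzero 1-morphisms gives a single one: duals reverse the direction, and composites
of nonzero bimodules are nonzero. -/
lemma exists_ne_zero (hconn : IsConnectedTwoCategory D.Obj) (hrigid : IsRigid D.Obj)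
    (A B : D.Obj) : ∃ (V : A ⟶ B) (v : bimodule V), v ≠ 0 := by
  induction hconn A B with
  | rel A B h => exact h.imp fun V hV => exists_ne_zero_of_not_isZero hV
  | refl A => exact ⟨𝟙 A, FieldBimodule.unitMk (1 : K A.base.index),
      one_ne_zero (α := K A.base.index)⟩
  | symm A B _ ih =>
    obtain ⟨V, v, hv⟩ := ih
    obtain ⟨⟨W, ⟨adj⟩⟩, -⟩ := hrigid V
    obtain ⟨s, c, hc, hs, -⟩ := exists_dual_bases adj
    refine ⟨W, ?_⟩
    by_contra! h
    refine hv ((hs v).symm.trans (Finset.sum_eq_zero fun p _ => ?_))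
    rw [h p.2, hc, op_zero, zero_smul]
  | trans A B E _ _ ih₁ ih₂ =>
    obtain ⟨V, v, hv⟩ := ih₁
    obtain ⟨W, w, hw⟩ := ih₂
    exact ⟨V ≫ W, FieldBimodule.tmul v w, FieldBimodule.tmul_ne_zero hv hw⟩

lemma finite_left (hrigid : IsRigid D.Obj) {A B : D.Obj} (V : A ⟶ B) :
    Module.Finite (K A.base.index) (bimodule V) := by
  classical
  obtain ⟨-, ⟨W, ⟨adj⟩⟩⟩ := hrigid V
  obtain ⟨s, c, -, -, hs⟩ := exists_dual_bases adj
  refine ⟨⟨s.image Prod.snd, eq_top_iff.2 fun v _ => ?_⟩⟩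
  rw [← hs v]
  exact Submodule.sum_mem _ fun p hp => Submodule.smul_mem _ _
    (Submodule.subset_span (Finset.mem_coe.2 (Finset.mem_image_of_mem _ hp)))

/-- The bimodules of a full sub-2-category, as a class of bimodules over the family `K`. -/
def bimoduleClass (D : FullSubTwoCategory (KModK K)) (i j : ι) :
    Set (FieldBimodule (K i) (K j)) :=
  {V | D.mem ⟨i⟩ ⟨j⟩ V}

lemma isConnectedClass (hconn : IsConnectedTwoCategory D.Obj) (hrigid : IsRigid D.Obj) :
    FieldBimodule.IsConnectedClass D.bimoduleClass where
  unit_mem i := D.id_mem ⟨i⟩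
  tensor_mem hV hW := D.comp_mem _ _ hV hW
  exists_ne_zero i j := by
    obtain ⟨V, v, hv⟩ := exists_ne_zero hconn hrigid (D := D) ⟨⟨i⟩⟩ ⟨⟨j⟩⟩
    exact ⟨V.obj, V.property, v, hv⟩

lemma relation_map {A B : D.Obj} {V W : A ⟶ B} (f : V ⟶ W) {κ : Type*} (s : Finset κ)
    (a : κ → K A.base.index) (b : κ → K B.base.index) (v : bimodule V) :
    ∑ x ∈ s, a x • op (b x) • (bimoduleHom f).hom v =
      (bimoduleHom f).hom (∑ x ∈ s, a x • op (b x) • v) := by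
  simp only [map_sum, FieldBimodule.Hom.map_left, FieldBimodule.Hom.map_right]

/-- By semisimplicity, the relations among operators `v ↦ a • v • b` are detected by representatives
of the simple bimodules. -/
lemma relation_of_simple (hss : IsSemisimpleTwoCategory D.Obj) {A B : D.Obj} {t : Set (A ⟶ B)}
    (ht : ∀ V : A ⟶ B, Simple V → ∃ W ∈ t, Nonempty (V ≅ W)) {κ : Type*} (s : Finset κ)
    (a : κ → K A.base.index) (b : κ → K B.base.index)
    (h : ∀ W ∈ t, ∀ w : bimodule W, ∑ x ∈ s, a x • op (b x) • w = 0)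
    (V : A ⟶ B) (v : bimodule V) : ∑ x ∈ s, a x • op (b x) • v = 0 := by
  have hsimple (W : A ⟶ B) (hW : Simple W) (w : bimodule W) :
      ∑ x ∈ s, a x • op (b x) • w = 0 := by
    obtain ⟨X, hX, ⟨e⟩⟩ := ht W hW
    have := congrArg (bimoduleHom e.inv).hom (h X hX ((bimoduleHom e.hom).hom w))
    rwa [← relation_map, ← comp_bimoduleHom_apply, e.hom_inv_id, map_zero] at this
  obtain ⟨n, Y, c, hY, ⟨hc⟩, ⟨e⟩⟩ := (hss A B).exists_decomposition V
  have hid : 𝟙 V = ∑ i, (e.hom ≫ c.π i) ≫ (c.ι i ≫ e.inv) := by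
    have := congrArg (fun f => e.hom ≫ f ≫ e.inv) (Limits.IsBilimit.total hc)
    simp only [Preadditive.comp_sum, Preadditive.sum_comp, Category.id_comp, e.hom_inv_id] at this
    simpa only [Category.assoc] using this.symm
  let ev : (V ⟶ V) →+ bimodule V := AddMonoidHom.mk' (fun f => (bimoduleHom f).hom v) fun _ _ => rfl
  have hv : v = ∑ i, (bimoduleHom (c.ι i ≫ e.inv)).hom ((bimoduleHom (e.hom ≫ c.π i)).hom v) := by
    have := congrArg ev hid
    rwa [map_sum] at this
  rw [hv]
  simp only [Finset.smul_sum]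
  rw [Finset.sum_comm]
  exact Finset.sum_eq_zero fun i _ => by rw [relation_map, hsimple _ (hY i), map_zero]

/-- Each field of the family is finite over the center: the simple 1-morphisms from an object to
itself detect all relations, and there are only finitely many of them. -/
lemma finite_eval_center (hconn : IsConnectedTwoCategory D.Obj) (hrigid : IsRigid D.Obj)
    (hss : IsSemisimpleTwoCategory D.Obj) (hfin : HasFinitelyManySimples D.Obj)
    {k : Type u} [Field k] (e : k ≃+* FieldBimodule.center D.bimoduleClass) (A : D.Obj) :
    (((Pi.evalRingHom K A.base.index).comp (FieldBimodule.center D.bimoduleClass).subtype).comp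
      e.toRingHom).Finite := by
  obtain ⟨t, ht, htV⟩ := hfin A A
  have : Finite t := ht
  have (W : t) : Module.Finite (K A.base.index) (bimodule W.1) := finite_left hrigid W.1
  exact (isConnectedClass hconn hrigid).finite_eval e (fun W : t => bimodule W.1)
    fun s a b h X hX v =>
      relation_of_simple hss htV s a b (fun W hW => h ⟨W, hW⟩) (⟨X, hX⟩ : A ⟶ A) v

end FullSubTwoCategory

/-! ### The forgetful functor -/

namespace FieldBimodule

variable {R S T k : Type u} [Field R] [Field S] [Field T] [Field k]

/-- The `k`-vector space underlying a bimodule `V`, where `k` acts on the left through `f`. -/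
def restrictScalars (V : FieldBimodule R S) (_ : k →+* R) : Type u := V.carrier

variable (V : FieldBimodule R S) (f : k →+* R)

instance : AddCommGroup (V.restrictScalars f) := inferInstanceAs (AddCommGroup V.carrier)

instance : Module k (V.restrictScalars f) := Module.compHom V.carrier f

lemma finite_restrictScalars [Module.Finite R V] (hf : f.Finite) :
    Module.Finite k (V.restrictScalars f) := by
  let := f.toAlgebra
  let : Module R (V.restrictScalars f) := inferInstanceAs (Module R V.carrier)
  have : Module.Finite R (V.restrictScalars f) := inferInstanceAs (Module.Finite R V.carrier)
  have : Module.Finite k R := hf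
  have : IsScalarTower k R (V.restrictScalars f) := .of_algebraMap_smul fun _ _ => rfl
  exact Module.Finite.trans R _

variable {V} in
/-- A homomorphism of bimodules, as a linear map of the underlying vector spaces. -/
def Hom.restrictScalars {W : FieldBimodule R S} (g : V ⟶ W) :
    V.restrictScalars f →ₗ[k] W.restrictScalars f where
  toFun := g.hom
  map_add' := g.hom.map_add
  map_smul' c := g.map_left (f c)

/-- The canonical projection `V ⊗_k W → V ⊗_S W`. -/
noncomputable def tensorProjection {W : FieldBimodule S T} (g : k →+* S)
    (hfg : ∀ (c : k) (v : V), f c • v = op (g c) • v) :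
    V.restrictScalars f ⊗[k] W.restrictScalars g →ₗ[k] (tensor V W).restrictScalars f :=
  TensorProduct.lift <| LinearMap.mk₂ k (fun (v : V) (w : W) => (tmul v w : tensor V W))
    add_tmul (fun _ _ _ => rfl) tmul_add fun c v w =>
      ((congrArg (fun v' => tmul v' (show W.carrier from w)) (hfg c v)).trans
        (balanced (g c) (show V.carrier from v) (show W.carrier from w))).symm

/-- The field `k`, mapped to the vector space underlying the identity bimodule. -/
def unitRestrictScalars : k →ₗ[k] (unit R).restrictScalars f where
  toFun c := unitMk (f c)
  map_add' := f.map_add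
  map_smul' := f.map_mul

end FieldBimodule

namespace FullSubTwoCategory

variable {ι : Type w} {K : ι → Type u} [∀ i, Field (K i)] {D : FullSubTwoCategory (KModK K)}

open Bicategory

variable {k : Type u} [Field k] {β : ∀ i, k →+* K i}
  (hβ : ∀ {A B : D.Obj} (V : A ⟶ B) (c : k) (v : bimodule V),
    β A.base.index c • v = op (β B.base.index c) • v)
  (hfin : ∀ {A B : D.Obj} (V : A ⟶ B),
    Module.Finite k ((bimodule V).restrictScalars (β A.base.index)))

/-- The lax functor that sends a bimodule to its underlying vector space. The two actions of `k`
have to agree for the projections `V ⊗_k W → V ⊗_B W` to exist. -/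
noncomputable def forgetfulLaxFunctor :
    LaxFunctor D.Obj (MonoidalSingleObj (FGModuleCat.{u} k)) where
  obj _ := MonoidalSingleObj.star _
  map {A _} V :=
    let := hfin V
    FGModuleCat.of k ((bimodule V).restrictScalars (β A.base.index))
  map₂ {A _ V W} f :=
    let := hfin V
    let := hfin W
    FGModuleCat.ofHom ((bimoduleHom f).restrictScalars (β A.base.index))
  map₂_id _ := rfl
  map₂_comp _ _ := rfl
  mapId A :=
    let := hfin (𝟙 A)
    FGModuleCat.ofHom (FieldBimodule.unitRestrictScalars (β A.base.index))
  mapComp {A B _} V W :=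
    let := hfin V
    let := hfin W
    let := hfin (V ≫ W)
    FGModuleCat.ofHom ((bimodule V).tensorProjection (β A.base.index) (β B.base.index) (hβ V))
  mapComp_naturality_left _ _ := FGModuleCat.hom_ext (TensorProduct.ext' fun _ _ => rfl)
  mapComp_naturality_right _ _ _ _ := FGModuleCat.hom_ext (TensorProduct.ext' fun _ _ => rfl)
  map₂_associator _ _ _ := FGModuleCat.hom_ext (TensorProduct.ext_threefold fun _ _ _ => rfl)
  map₂_leftUnitor {A _} V := FGModuleCat.hom_ext <| LinearMap.ext fun v =>
    congrArg (fun r => FieldBimodule.tmul (V := FieldBimodule.unit _) (W := bimodule V)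
        (FieldBimodule.unitMk r) v)
      (map_one (β A.base.index)).symm
  map₂_rightUnitor {_ B} V := FGModuleCat.hom_ext <| LinearMap.ext fun v =>
    congrArg (fun r => FieldBimodule.tmul (V := bimodule V) (W := FieldBimodule.unit _)
        v (FieldBimodule.unitMk r))
      (map_one (β B.base.index)).symm

/-- If the two actions of `k` through `β` agree on all 1-morphisms of `D` and make them
finite-dimensional, then `D` admits a forgetful functor to vector spaces over `k`. -/
noncomputable def forgetfulFunctor : D.ForgetfulFunctor k β where
  functor := forgetfulLaxFunctor hβ hfin
  iso V := AddEquiv.refl (bimodule V)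
  iso_left _ _ _ := rfl
  iso_right V c v := (hβ V c v).symm
  iso_naturality _ _ := rfl
  unitMap_apply _ _ := rfl
  compMap_tmul _ _ _ _ := rfl

end FullSubTwoCategory

/-! ### Existence of the forgetful functor -/

/-- Let `K` be a finite family of fields, and `D` a full, connected, rigid, semisimple
sub-2-category of the 2-category of bimodules over `K`, with finitely many simple 1-morphisms and
no inseparable extensions. Then `D` admits a forgetful functor to finite-dimensional vector spaces
over a field that embeds in every member of `K`. -/
theorem corollary3 {ι : Type w} [Finite ι] (K : ι → Type u) [∀ i, Field (K i)]
    (D : FullSubTwoCategory (KModK K))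
    (hconn : IsConnectedTwoCategory D.Obj)
    (hrigid : IsRigid D.Obj)
    (hss : IsSemisimpleTwoCategory D.Obj)
    (hfin : HasFinitelyManySimples D.Obj)
    (hsep : D.HasNoInseparableExtensions) :
    ∃ (k : Type u) (_ : Field k) (β : ∀ i, k →+* K i), Nonempty (D.ForgetfulFunctor k β) := by
  rcases isEmpty_or_nonempty ι with hι | ⟨⟨o⟩⟩
  · -- Over the empty family any field will do.
    exact ⟨ULift ℚ, inferInstance, fun i => isEmptyElim i,
      ⟨FullSubTwoCategory.forgetfulFunctor (fun {A} => (hι.false A.base.index).elim)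
        (fun {A} => (hι.false A.base.index).elim)⟩⟩
  have : Nonempty ι := ⟨o⟩
  have hM := FullSubTwoCategory.isConnectedClass hconn hrigid
  let Z := FieldBimodule.center D.bimoduleClass
  let ev (i : ι) : Z →+* K i := (Pi.evalRingHom K i).comp Z.subtype
  have hinj : Function.Injective (ev o) := (injective_iff_map_eq_zero _).2 fun x hx =>
    Subtype.ext (hM.eq_zero_of_apply_eq_zero x.2 hx)
  -- The center itself lives in `Type (max u w)`; its image in `K o` lives in `Type u`.
  let k : Subring (K o) := (ev o).range
  let e : k ≃+* Z := (RingEquiv.ofBijective (ev o).rangeRestrict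
    ⟨RingHom.injective_codRestrict.2 hinj, (ev o).rangeRestrict_surjective⟩).symm
  let : Field k := (e.toMulEquiv.isField hM.isField_center).toField
  let β (i : ι) : k →+* K i := (ev i).comp e.toRingHom
  have hβ : ∀ {A B : D.Obj} (V : A ⟶ B) (c : k) (v : FullSubTwoCategory.bimodule V),
      β A.base.index c • v = op (β B.base.index c) • v := fun V c v =>
    (e c).2 _ _ V.obj V.property v
  refine ⟨k, inferInstance, β, ⟨FullSubTwoCategory.forgetfulFunctor hβ fun {A B} V => ?_⟩⟩
  have hA : (β A.base.index).Finite :=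
    FullSubTwoCategory.finite_eval_center hconn hrigid hss hfin e A
  have := FullSubTwoCategory.finite_left hrigid V
  exact (FullSubTwoCategory.bimodule V).finite_restrictScalars _ hA
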